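/- Let $\mathcal X$ be a finite set, let $1 \le n_0 \le n$ be integers, let $\sigma_\tau > 0$ and $k_\tau \in \{0,1,2,\dots\}$ for $n_0 \le \tau \le n$ be fixed in advance. A statistical query is a function $q : \mathcal X \to [0,1]$; its value on $(x_1,\dots,x_t)$ is $q(x_1,\dots,x_t) = \frac1t \sum_{i=1}^t q(x_i)$. Given $(x_1,\dots,x_t)$, the Gaussian mechanism $\mathsf M$ answers $q$ with $q(x_1,\dots,x_t) + z$, where $z \sim \mathcal N(0,\sigma_t^2)$ is fresh noise; the clipped Gaussian mechanism answers $\max(0,\min(q(x_1,\dots,x_t)+z,1))$. An analyst $\mathsf A$ is a randomized map (Markov kernel) from transcripts to statistical queries. For a dataset $\vec x \in \mathcal X^n$, the interaction $I(\vec x;\mathsf A,\mathsf M)$ starts with the empty transcript $\Pi = (\Pi_1,\dots,\Pi_n)$ and, in each round $t = n_0, n_0+1, \dots, n$ in turn, does the following $k_t$ times: draw $Q \sim \mathsf A(\Pi)$, draw the answer $R \sim \mathsf M(Q; x_1,\dots,x_t)$, and append $(Q,R)$ to $\Pi_t$. Its output is the final transcript $\Pi$. Write $(\vec x,\vec x')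 \in \mathcal N_t$ if $\vec x,\vec x' \in \mathcal X^n$ agree except possibly in the $t$-th entry. Let $\vec\rho : \{1,\dots,n\} \to [0,\infty)$, $\epsilon \ge 0$ and $\vec\delta : \{1,\dots,n\} \to [0,1]$. * The interaction with $\mathsf M$ is $\vec\rho$-zCDP if for all analysts $\mathsf A$, all $t \in \{1,\dots,n\}$ and all $(\vec x,\vec x') \in \mathcal N_t$, the law $P$ of $I(\vec x;\mathsf A,\mathsf M)$ is absolutely continuous with respect to the law $P'$ of $I(\vec x';\mathsf A,\mathsf M)$, and the privacy loss $Z = \log \frac{dP}{dP'}(Y)$, $Y \sim P$, satisfies $\mathbb E\, e^{s Z} \le e^{s(s+1)\vec\rho(t)}$ for all $s \ge 0$. * The interaction with $\mathsf M$ is $(\epsilon,\vec\delta)$-DP if for all analysts $\mathsf A$, all $t$, all $(\vec x,\vec x') \in \mathcal N_t$ and all measurable sets $E$ of transcripts, $\Pr(I(\vec x;\mathsf A,\mathsf M) \in E) \le e^{\epsilon} \Pr(I(\vec x';\mathsf A,\mathsf M) \in E) + \vec\delta(t)$. Let $$\vec\rho(t) = \sum_{\tau=n_0}^{n} \frac{k_\tau\,\mathbf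 1\{t \le \tau\}}{2\sigma_\tau^2\tau^2}, \qquad \psi(\gamma,\rho,\epsilon) = \frac{e^{(\gamma-1)(\gamma\rho-\epsilon)}}{\gamma-1}\left(1-\frac1\gamma\right)^{\gamma}.$$ Then, for $\mathsf M$ the ordinary or the clipped Gaussian mechanism: 1. The interaction with $\mathsf M$ is $\vec\rho$-zCDP. 2. Let $\epsilon > 0$, and suppose that at least one $k_\tau$ is positive. Then $\gamma \mapsto \psi(\gamma, \max_{1 \le t \le n} \vec\rho(t), \epsilon)$ has a unique minimizer $\gamma^\star$ on $(1,\infty)$, and the interaction with $\mathsf M$ is $(\epsilon,\vec\delta)$-DP with $\vec\delta(t) = \psi(\gamma^\star, \vec\rho(t), \epsilon)$; in particular these values lie in $[0,1]$. -/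

import Mathlib

open MeasureTheory ProbabilityTheory

noncomputable section

namespace GrowingADA

/-- Indices `1, …, n` of data points, equivalently of rounds: round `t` is the one in which the
dataset has size `t`. -/
abbrev Idx (n : ℕ) : Type := ↥(Finset.Icc 1 n)

/-- A growing dataset over the horizon `n`: the points `x_1, …, x_n` in order of arrival. -/
abbrev Dataset (n : ℕ) (X : Type*) : Type _ := Idx n → X

/-- The snapshot `(x_1, …, x_t)` of a growing dataset; its entry number `i : Fin t` is `x_{i+1}`. -/
def snapshot {n : ℕ} {X : Type*} (x : Dataset n X) (t : Idx n) : Fin t.1 → X :=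
  fun i => x ⟨i.1 + 1, Finset.mem_Icc.2
    ⟨Nat.succ_le_succ (Nat.zero_le _), le_trans (Nat.succ_le_of_lt i.2) (Finset.mem_Icc.1 t.2).2⟩⟩

/-- `x` and `x'` are neighbours at `t`: one is obtained from the other by replacing the `t`-th
data point. -/
def Neighbor {n : ℕ} {X : Type*} (t : Idx n) (x x' : Dataset n X) : Prop :=
  ∀ i, i ≠ t → x i = x' i

/-- Statistical queries, each given by a function from the data domain to `[0, 1]`. -/
abbrev Query (X : Type*) : Type _ := X → unitInterval

/-- The value `(∑ q(x_i)) / t` of a statistical query on a snapshot of size `t`. -/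
def Query.eval {X : Type*} (q : Query X) {t : ℕ} (s : Fin t → X) : ℝ :=
  (∑ i, (q (s i) : ℝ)) / t

/-- Finite sequences of elements of `α`, with the disjoint-union σ-algebra. -/
abbrev FinSeq (α : Type*) : Type _ := Σ m : ℕ, Fin m → α

/-- Append one element at the end of a finite sequence. -/
def FinSeq.append {α : Type*} (l : FinSeq α) (a : α) : FinSeq α := ⟨l.1 + 1, Fin.snoc l.2 a⟩

/-- Transcripts `(Π_1, …, Π_n)`, where `Π_t` is the finite sequence of (query, response) pairs of
round `t`. -/
abbrev Transcript (n : ℕ) (X : Type*) : Type _ := Idx n → FinSeq (Query X × ℝ)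

/-- The empty transcript. -/
def Transcript.empty (n : ℕ) (X : Type*) : Transcript n X := fun _ => ⟨0, Fin.elim0⟩

/-- Append a (query, response) pair to `Π_t`. -/
def Transcript.record {n : ℕ} {X : Type*} (t : Idx n) (p : Transcript n X × (Query X × ℝ)) :
    Transcript n X :=
  Function.update p.1 t ((p.1 t).append p.2)

/-- A mechanism: given a snapshot of size `t`, a randomized response to every query. -/
abbrev Mechanism (X : Type*) : Type _ := (t : ℕ) → (Fin t → X) → Kernel (Query X) ℝ

/-- An analyst chooses the next query at random, given the transcript so far. The number of
queries in each round is not chosen by the analyst during the interaction: it is the parameter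
`k` of `interact`. -/
abbrev Analyst (n : ℕ) (X : Type*) : Type _ := Kernel (Transcript n X) (Query X)

theorem measurable_eval {X : Type*} {t : ℕ} (s : Fin t → X) :
    Measurable fun q : Query X => q.eval s := by
  unfold Query.eval
  refine Measurable.div_const (Finset.measurable_sum _ fun i _ => ?_) _
  exact measurable_subtype_coe.comp (measurable_pi_apply (s i))

/-- The Gaussian mechanism: on a snapshot of size `t` it responds `q(s) + z` with
`z ∼ N(0, σ_t²)`. -/
def gaussianMechanism {X : Type*} (σ : ℕ → ℝ) : Mechanism X := fun t s =>
  { toFun := fun q => (gaussianReal 0 (Real.toNNReal (σ t ^ 2))).map fun z => q.eval s + z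
    measurable' := by
      refine Measure.measurable_of_measurable_coe _ fun B hB => ?_
      have hf : Measurable fun p : Query X × ℝ => p.1.eval s + p.2 :=
        ((measurable_eval s).comp measurable_fst).add measurable_snd
      have h := measurable_measure_prodMk_left
        (ν := gaussianReal 0 (Real.toNNReal (σ t ^ 2))) (hf hB)
      convert h using 2 with q
      exact Measure.map_apply (measurable_const_add _) hB }

/-- The map `x ↦ max(0, min(x, 1))`. -/
def clamp (x : ℝ) : ℝ := max 0 (min x 1)

theorem measurable_clamp : Measurable clamp :=
  measurable_const.max (measurable_id.min measurable_const)

/-- The clipped Gaussian mechanism: the response of the Gaussian mechanism, clamped to `[0, 1]`. -/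
def clippedGaussianMechanism {X : Type*} (σ : ℕ → ℝ) : Mechanism X := fun t s =>
  (gaussianMechanism σ t s).map clamp

theorem measurableEmbedding_sigmaMk {α : Type*} [MeasurableSpace α] (m : ℕ) :
    MeasurableEmbedding (fun v : Fin m → α => (⟨m, v⟩ : FinSeq α)) where
  injective := fun _ _ h => eq_of_heq (Sigma.mk.inj h).2
  measurable := measurable_iff_le_map.2 (iInf_le _ m)
  measurableSet_image' := by
    intro s hs
    refine MeasurableSpace.measurableSet_iInf.2 fun m' => ?_
    change MeasurableSet ((Sigma.mk m') ⁻¹' ((fun v : Fin m → α => (⟨m, v⟩ : FinSeq α)) '' s))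
    by_cases h : m' = m
    · subst h
      rwa [Set.preimage_image_eq _ sigma_mk_injective]
    · convert MeasurableSet.empty
      ext v
      simp only [Set.mem_preimage, Set.mem_image, Set.mem_empty_iff_false, iff_false]
      rintro ⟨w, _, hw⟩
      exact h (congrArg Sigma.fst hw).symm

theorem measurable_append {α : Type*} [MeasurableSpace α] :
    Measurable fun p : FinSeq α × α => p.1.append p.2 := by
  intro S hS
  have key : (fun p : FinSeq α × α => p.1.append p.2) ⁻¹' S =
      ⋃ m : ℕ, Prod.map (fun v : Fin m → α => (⟨m, v⟩ : FinSeq α)) id ''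
        ((fun p : (Fin m → α) × α => (⟨m + 1, Fin.snoc p.1 p.2⟩ : FinSeq α)) ⁻¹' S) := by
    ext ⟨⟨m, v⟩, a⟩
    simp only [Set.mem_preimage, Set.mem_iUnion, Set.mem_image, Prod.exists]
    constructor
    · intro h
      exact ⟨m, v, a, h, rfl⟩
    · rintro ⟨m', v', a', h, he⟩
      have h' : (fun p : FinSeq α × α => p.1.append p.2)
          (Prod.map (fun v : Fin m' → α => (⟨m', v⟩ : FinSeq α)) id (v', a')) ∈ S := h
      rw [he] at h'
      exact h'
  rw [key]
  refine MeasurableSet.iUnion fun m => ?_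
  refine ((measurableEmbedding_sigmaMk m).prodMap MeasurableEmbedding.id).measurableSet_image' ?_
  refine ((measurableEmbedding_sigmaMk (m + 1)).measurable.comp ?_) hS
  refine measurable_pi_lambda _ fun i => ?_
  refine Fin.lastCases ?_ (fun j => ?_) i
  · simpa using measurable_snd
  · simp only [Fin.snoc_castSucc]
    exact (measurable_pi_apply j).comp measurable_fst

theorem measurable_record {n : ℕ} {X : Type*} (t : Idx n) :
    Measurable (Transcript.record (n := n) (X := X) t) := by
  refine measurable_pi_lambda _ fun i => ?_
  by_cases h : i = t
  · subst h
    have h1 : Measurable fun p : Transcript n X × (Query X × ℝ) => p.1 i :=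
      (measurable_pi_apply i).comp measurable_fst
    simpa [Transcript.record, Function.comp_def] using
      measurable_append.comp (h1.prodMk measurable_snd)
  · simp only [Transcript.record, Function.update_of_ne h]
    exact (measurable_pi_apply i).comp measurable_fst

/-- One query in round `t`: from the transcript `Π` so far, draw `Q ∼ A(Π)`, then
`R ∼ M(Q; x_1, …, x_t)`, and append `(Q, R)` to `Π_t`. -/
def queryStep {n : ℕ} {X : Type*} (A : Analyst n X) (M : Mechanism X) (x : Dataset n X)
    (t : Idx n) : Kernel (Transcript n X) (Transcript n X) :=
  (Kernel.id ×ₖ (A ⊗ₖ (M t (snapshot x t)).prodMkLeft (Transcript n X))).map (Transcript.record t)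

/-- The rounds `n₀, …, n` in which queries are submitted. -/
def rounds (n n₀ : ℕ) : Finset (Idx n) := {τ | n₀ ≤ τ.1}

/-- The law of the transcript of the interaction on the dataset `x`: starting from the empty
transcript, the rounds `n₀, …, n` are run in increasing order, with `k t` queries in round `t`. -/
def interact {n : ℕ} {X : Type*} (n₀ : ℕ) (k : ℕ → ℕ) (A : Analyst n X) (M : Mechanism X)
    (x : Dataset n X) : Measure (Transcript n X) :=
  ((rounds n n₀).sort (· ≤ ·)).foldl
    (fun μ t => (fun ν : Measure (Transcript n X) => ν.bind (queryStep A M x t))^[k t] μ)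
    (Measure.dirac (Transcript.empty n X))

/-- The privacy loss distribution: the law under `P` of the logarithm of `dP/dQ`. -/
def privLoss {Y : Type*} [MeasurableSpace Y] (P Q : Measure Y) : Measure ℝ := P.map (llr P Q)

/-- Zero-concentrated differential privacy of a randomized map on datasets, with a privacy
parameter for each data point. The privacy loss distribution is well defined when `P ≪ Q`. -/
def IsZCDP {n : ℕ} {X Y : Type*} [MeasurableSpace Y] (F : Dataset n X → Measure Y)
    (ρ : Idx n → ℝ) : Prop :=
  (∀ i, 0 ≤ ρ i) ∧ ∀ i x x', Neighbor i x x' → F x ≪ F x' ∧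
    ∀ τ : ℝ, 0 ≤ τ → ∫⁻ z, ENNReal.ofReal (Real.exp (τ * z)) ∂(privLoss (F x) (F x')) ≤
      ENNReal.ofReal (Real.exp (τ * (τ + 1) * ρ i))

/-- Approximate differential privacy of a randomized map on datasets, with an additive parameter
for each data point. -/
def IsApproxDP {n : ℕ} {X Y : Type*} [MeasurableSpace Y] (F : Dataset n X → Measure Y)
    (ε : ℝ) (δ : Idx n → ℝ) : Prop :=
  0 ≤ ε ∧ (∀ i, δ i ∈ Set.Icc (0 : ℝ) 1) ∧ ∀ i x x', Neighbor i x x' →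
    ∀ E : Set Y, MeasurableSet E → (F x).real E ≤ Real.exp ε * (F x').real E + δ i

/-- The interaction with `M`, with `k t` queries in round `t`, is `ρ`-zCDP for all analysts. -/
def InteractionZCDP {n : ℕ} {X : Type*} (n₀ : ℕ) (k : ℕ → ℕ) (M : Mechanism X)
    (ρ : Idx n → ℝ) : Prop :=
  ∀ A : Analyst n X, IsMarkovKernel A → IsZCDP (interact n₀ k A M) ρ

/-- The interaction with `M`, with `k t` queries in round `t`, is `(ε, δ)`-DP for all analysts. -/
def InteractionDP {n : ℕ} {X : Type*} (n₀ : ℕ) (k : ℕ → ℕ) (M : Mechanism X)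
    (ε : ℝ) (δ : Idx n → ℝ) : Prop :=
  ∀ A : Analyst n X, IsMarkovKernel A → IsApproxDP (interact n₀ k A M) ε δ

/-- `ρ(t) = ∑_{τ = n₀}^{n} k_τ 1{t ≤ τ} / (2 σ_τ² τ²)`. -/
def rho (n n₀ : ℕ) (k : ℕ → ℕ) (σ : ℕ → ℝ) (t : Idx n) : ℝ :=
  ∑ τ ∈ Finset.Icc n₀ n,
    (k τ : ℝ) * (if (t : ℕ) ≤ τ then 1 else 0) / (2 * σ τ ^ 2 * (τ : ℝ) ^ 2)

/-- `ψ(γ, ρ, ε) = exp((γ - 1)(γ ρ - ε)) (1 - 1/γ)^γ / (γ - 1)`. -/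
def psi (γ ρ ε : ℝ) : ℝ :=
  Real.exp ((γ - 1) * (γ * ρ - ε)) * (1 - γ⁻¹) ^ γ / (γ - 1)

/-- `γ` minimizes `ψ(·, ρ, ε)` over `(1, ∞)`. -/
def IsOptimalOrder (ρ ε γ : ℝ) : Prop :=
  1 < γ ∧ ∀ γ' : ℝ, 1 < γ' → psi γ ρ ε ≤ psi γ' ρ ε

end GrowingADA

end

open GrowingADA

/-!
Privacy loss is measured by the Rényi moments `𝔼_Q[(dP/dQ)^α]`, `α > 1`. Since the density of a
pushforward is a conditional expectation, these moments do not grow under measurable maps, and they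
multiply along adaptive composition. Between `N(m, v)` and `N(m', v)` the moment is
`exp(α(α - 1)(m - m')²/(2v))`. Replacing one of `t` points moves the value of a statistical query by
at most `1/t`, so each query of round `t ≥ i` costs `1/(2σ_t²t²)` at position `i`, and a query of an
earlier round costs nothing.

For approximate DP, `x ≤ e^ε + ψ(γ, 0, ε) x^γ` is the tangent-line inequality for `x ↦ x^γ`; taken
at `x = dP/dQ` and integrated over an event, it produces `δ = ψ(γ, ρ, ε)`. The function `log ψ` is
strictly convex in `γ > 1` with derivative running from `-∞` to `+∞`, hence the unique optimal
order; as `γ → 1` it tends to `0`, so the optimal `δ` is at most `1`.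
-/

namespace GrowingADA

open scoped ENNReal NNReal

section RenyiMoment

variable {Y Z : Type*} [MeasurableSpace Y] [MeasurableSpace Z] {P Q : Measure Y}

/-- The moment `𝔼_Q[(dP/dQ)^α]`, which is `exp((α - 1) D_α(P ‖ Q))` for the Rényi divergence `D_α`
of order `α`. Only the part of `P` that is absolutely continuous with respect to `Q` enters. -/
noncomputable def renyiMoment (α : ℝ) (P Q : Measure Y) : ℝ≥0∞ :=
  ∫⁻ y, P.rnDeriv Q y ^ α ∂Q

theorem renyiMoment_self (α : ℝ) (P : Measure Y) [IsProbabilityMeasure P] :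
    renyiMoment α P P = 1 := by
  have hone : (fun y => P.rnDeriv P y ^ α) =ᵐ[P] fun _ => 1 := by
    filter_upwards [P.rnDeriv_self] with y hy
    rw [hy, ENNReal.one_rpow]
  rw [renyiMoment, lintegral_congr_ae hone, lintegral_one, measure_univ]

theorem renyiMoment_withDensity (α : ℝ) (Q : Measure Y) [SigmaFinite Q] {f : Y → ℝ≥0∞}
    (hf : Measurable f) : renyiMoment α (Q.withDensity f) Q = ∫⁻ y, f y ^ α ∂Q := by
  refine lintegral_congr_ae ?_
  filter_upwards [Q.rnDeriv_withDensity hf] with y hy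
  rw [hy]

theorem renyiMoment_eq_eLpNorm_rpow {α : ℝ} (hα : 0 < α) (P Q : Measure Y) [SigmaFinite P] :
    renyiMoment α P Q = eLpNorm (fun y => (P.rnDeriv Q y).toReal) (ENNReal.ofReal α) Q ^ α := by
  rw [eLpNorm_eq_eLpNorm' (by simpa using hα) ENNReal.ofReal_ne_top, ENNReal.toReal_ofReal hα.le,
    ← lintegral_rpow_enorm_eq_rpow_eLpNorm' hα]
  refine lintegral_congr_ae ?_
  filter_upwards [P.rnDeriv_ne_top Q] with y hy
  rw [← ofReal_norm, Real.norm_of_nonneg ENNReal.toReal_nonneg, ENNReal.ofReal_toReal hy]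

/-- The density of the images is a conditional expectation of the original density, and
conditional expectation is a contraction on `L^α`. -/
theorem renyiMoment_map_le [IsFiniteMeasure P] [IsFiniteMeasure Q] (hPQ : P ≪ Q) {α : ℝ}
    (hα : 1 ≤ α) {T : Y → Z} (hT : Measurable T) :
    renyiMoment α (P.map T) (Q.map T) ≤ renyiMoment α P Q := by
  have hα₀ : 0 < α := one_pos.trans_le hα
  have hmeas : Measurable fun z => ((P.map T).rnDeriv (Q.map T) z).toReal := by fun_prop
  rw [renyiMoment_eq_eLpNorm_rpow hα₀, renyiMoment_eq_eLpNorm_rpow hα₀,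
    eLpNorm_map_measure hmeas.aestronglyMeasurable hT.aemeasurable]
  refine ENNReal.rpow_le_rpow ?_ hα₀.le
  exact (eLpNorm_congr_ae (toReal_rnDeriv_map hPQ hT)).trans_le
    (eLpNorm_condExp_le_eLpNorm _ (ENNReal.one_le_ofReal.2 hα))

theorem renyiMoment_compProd_left (α : ℝ) (P Q : Measure Y) [IsFiniteMeasure P]
    [IsFiniteMeasure Q] (κ : Kernel Y Z) [IsMarkovKernel κ] :
    renyiMoment α (P ⊗ₘ κ) (Q ⊗ₘ κ) = renyiMoment α P Q := by
  calc renyiMoment α (P ⊗ₘ κ) (Q ⊗ₘ κ) = ∫⁻ p, P.rnDeriv Q p.1 ^ α ∂(Q ⊗ₘ κ) := by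
        refine lintegral_congr_ae ?_
        filter_upwards [rnDeriv_measure_compProd_left P Q κ] with p hp
        rw [hp]
    _ = renyiMoment α P Q := by
        rw [Measure.lintegral_compProd (by fun_prop)]
        simp only [lintegral_const, measure_univ, mul_one, renyiMoment]

section CompProd

variable [MeasurableSpace.CountableOrCountablyGenerated Y Z] [IsFiniteMeasure P]
  [IsFiniteMeasure Q] {κ η : Kernel Y Z} [IsFiniteKernel κ] [IsFiniteKernel η]

theorem compProd_eq_withDensity_rnDeriv_mul (hPQ : P ≪ Q) (hκη : ∀ y, κ y ≪ η y) :
    P ⊗ₘ κ = (Q ⊗ₘ η).withDensity fun p => κ.rnDeriv η p.1 p.2 * P.rnDeriv Q p.1 := by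
  have hκ : η.withDensity (κ.rnDeriv η) = κ :=
    Kernel.ext fun y => Kernel.withDensity_rnDeriv_eq (hκη y)
  have : IsFiniteKernel (η.withDensity (κ.rnDeriv η)) := by rw [hκ]; infer_instance
  calc P ⊗ₘ κ = (Q ⊗ₘ κ).withDensity ((P ⊗ₘ κ).rnDeriv (Q ⊗ₘ κ)) :=
        (Measure.withDensity_rnDeriv_eq _ _ (hPQ.compProd_left κ)).symm
    _ = (Q ⊗ₘ κ).withDensity fun p => P.rnDeriv Q p.1 :=
        withDensity_congr_ae (rnDeriv_measure_compProd_left P Q κ)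
    _ = ((Q ⊗ₘ η).withDensity fun p => κ.rnDeriv η p.1 p.2).withDensity
          fun p => P.rnDeriv Q p.1 := by
        rw [← Measure.compProd_withDensity (Kernel.measurable_rnDeriv κ η), hκ]
    _ = (Q ⊗ₘ η).withDensity fun p => κ.rnDeriv η p.1 p.2 * P.rnDeriv Q p.1 :=
        (withDensity_mul _ (Kernel.measurable_rnDeriv κ η) (by fun_prop)).symm

theorem renyiMoment_compProd (hPQ : P ≪ Q) (hκη : ∀ y, κ y ≪ η y) {α : ℝ} (hα : 0 ≤ α) :
    renyiMoment α (P ⊗ₘ κ) (Q ⊗ₘ η) =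
      ∫⁻ y, renyiMoment α (κ y) (η y) * P.rnDeriv Q y ^ α ∂Q := by
  have hmeas : Measurable fun p : Y × Z => κ.rnDeriv η p.1 p.2 * P.rnDeriv Q p.1 :=
    (Kernel.measurable_rnDeriv κ η).mul (by fun_prop)
  rw [compProd_eq_withDensity_rnDeriv_mul hPQ hκη, renyiMoment_withDensity α _ hmeas,
    Measure.lintegral_compProd (hmeas.pow_const α)]
  refine lintegral_congr fun y => ?_
  simp only [ENNReal.mul_rpow_of_nonneg _ _ hα]
  rw [lintegral_mul_const _ ((Kernel.measurable_rnDeriv_right κ η y).pow_const α)]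
  congr 1
  refine lintegral_congr_ae ?_
  filter_upwards [Kernel.rnDeriv_eq_rnDeriv_measure (κ := κ) (η := η) (a := y)] with z hz
  rw [hz]

end CompProd

theorem lintegral_exp_mul_privLoss [SigmaFinite P] [SigmaFinite Q] (hPQ : P ≪ Q) {s : ℝ}
    (hs : 0 ≤ s) :
    ∫⁻ z, ENNReal.ofReal (Real.exp (s * z)) ∂(privLoss P Q) = renyiMoment (s + 1) P Q := by
  have hexp : ∀ᵐ y ∂P, ENNReal.ofReal (Real.exp (s * llr P Q y)) = P.rnDeriv Q y ^ s := by
    filter_upwards [exp_llr_of_ac P Q hPQ, hPQ (P.rnDeriv_ne_top Q)] with y hy hfin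
    rw [mul_comm, Real.exp_mul, hy, ← ENNReal.ofReal_rpow_of_nonneg ENNReal.toReal_nonneg hs,
      ENNReal.ofReal_toReal hfin]
  calc ∫⁻ z, ENNReal.ofReal (Real.exp (s * z)) ∂(privLoss P Q)
      = ∫⁻ y, ENNReal.ofReal (Real.exp (s * llr P Q y)) ∂P :=
        lintegral_map (by fun_prop) (measurable_llr P Q)
    _ = ∫⁻ y, P.rnDeriv Q y ^ s ∂P := lintegral_congr_ae hexp
    _ = ∫⁻ y, P.rnDeriv Q y * P.rnDeriv Q y ^ s ∂Q :=
        (lintegral_rnDeriv_mul hPQ (by fun_prop)).symm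
    _ = renyiMoment (s + 1) P Q := by
        refine lintegral_congr fun y => ?_
        rw [add_comm, ENNReal.rpow_add_of_nonneg _ _ zero_le_one hs, ENNReal.rpow_one]

end RenyiMoment

section ApproxDP

variable {Y : Type*} [MeasurableSpace Y] {P Q : Measure Y} {γ : ℝ}

theorem psi_nonneg (hγ : 1 ≤ γ) (ρ ε : ℝ) : 0 ≤ psi γ ρ ε := by
  have hbase : 0 ≤ 1 - γ⁻¹ := sub_nonneg.2 (inv_le_one_of_one_le₀ hγ)
  have hden : 0 ≤ γ - 1 := sub_nonneg.2 hγ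
  exact div_nonneg (mul_nonneg (Real.exp_nonneg _) (Real.rpow_nonneg hbase γ)) hden

theorem psi_eq_psi_zero_mul_exp (γ ρ ε : ℝ) :
    psi γ ρ ε = psi γ 0 ε * Real.exp ((γ - 1) * γ * ρ) := by
  have hexp : (γ - 1) * (γ * ρ - ε) = (γ - 1) * (γ * 0 - ε) + (γ - 1) * γ * ρ := by ring
  rw [psi, psi, hexp, Real.exp_add]
  ring

/-- Bernoulli's inequality `1 + γ s ≤ (1 + s) ^ γ` at `s = (1 - γ⁻¹) y - 1`. -/
theorem sub_one_mul_sub_one_le_rpow (hγ : 1 ≤ γ) {y : ℝ} (hy : 0 ≤ y) :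
    (γ - 1) * (y - 1) ≤ (1 - γ⁻¹) ^ γ * y ^ γ := by
  have hbase : 0 ≤ 1 - γ⁻¹ := sub_nonneg.2 (inv_le_one_of_one_le₀ hγ)
  have hγ₀ : γ ≠ 0 := by positivity
  have bernoulli := one_add_mul_self_le_rpow_one_add (s := (1 - γ⁻¹) * y - 1)
    (by linarith [mul_nonneg hbase hy]) hγ
  rw [add_sub_cancel, Real.mul_rpow hbase hy] at bernoulli
  calc (γ - 1) * (y - 1) = 1 + γ * ((1 - γ⁻¹) * y - 1) := by field_simp; ring
    _ ≤ (1 - γ⁻¹) ^ γ * y ^ γ := bernoulli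

theorem le_exp_add_psi_zero_mul_rpow (hγ : 1 < γ) (ε : ℝ) {x : ℝ} (hx : 0 ≤ x) :
    x ≤ Real.exp ε + psi γ 0 ε * x ^ γ := by
  obtain ⟨y, hy, rfl⟩ : ∃ y, 0 ≤ y ∧ x = Real.exp ε * y :=
    ⟨Real.exp (-ε) * x, by positivity, by rw [← mul_assoc, ← Real.exp_add]; simp⟩
  have hden : 0 < γ - 1 := sub_pos.2 hγ
  have hle : y ≤ 1 + (1 - γ⁻¹) ^ γ * y ^ γ / (γ - 1) := by
    rw [← sub_le_iff_le_add', le_div_iff₀' hden]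
    exact sub_one_mul_sub_one_le_rpow hγ.le hy
  have hexp : Real.exp ((γ - 1) * (γ * 0 - ε)) * Real.exp ε ^ γ = Real.exp ε := by
    rw [← Real.exp_mul, ← Real.exp_add]
    ring_nf
  calc Real.exp ε * y ≤ Real.exp ε * (1 + (1 - γ⁻¹) ^ γ * y ^ γ / (γ - 1)) := by gcongr
    _ = Real.exp ε + Real.exp ((γ - 1) * (γ * 0 - ε)) * Real.exp ε ^ γ *
          ((1 - γ⁻¹) ^ γ * y ^ γ / (γ - 1)) := by rw [hexp]; ring
    _ = Real.exp ε + psi γ 0 ε * (Real.exp ε * y) ^ γ := by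
        rw [Real.mul_rpow (Real.exp_nonneg ε) hy, psi]; ring

theorem measure_le_exp_mul_add_psi_zero_mul_renyiMoment [SigmaFinite P] [SigmaFinite Q]
    (hPQ : P ≪ Q) (hγ : 1 < γ) (ε : ℝ) (E : Set Y) :
    P E ≤ ENNReal.ofReal (Real.exp ε) * Q E +
      ENNReal.ofReal (psi γ 0 ε) * renyiMoment γ P Q := by
  have hpointwise : ∀ᵐ y ∂Q, P.rnDeriv Q y ≤
      ENNReal.ofReal (Real.exp ε) + ENNReal.ofReal (psi γ 0 ε) * P.rnDeriv Q y ^ γ := by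
    filter_upwards [P.rnDeriv_ne_top Q] with y hy
    lift P.rnDeriv Q y to ℝ≥0 using hy with x
    have hψ := psi_nonneg hγ.le 0 ε
    rw [← ENNReal.ofReal_coe_nnreal, ENNReal.ofReal_rpow_of_nonneg x.coe_nonneg (by linarith),
      ← ENNReal.ofReal_mul hψ, ← ENNReal.ofReal_add (Real.exp_nonneg _) (by positivity)]
    exact ENNReal.ofReal_le_ofReal (le_exp_add_psi_zero_mul_rpow hγ ε x.coe_nonneg)
  calc P E = ∫⁻ y in E, P.rnDeriv Q y ∂Q := (Measure.setLIntegral_rnDeriv hPQ E).symm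
    _ ≤ ∫⁻ y in E, (ENNReal.ofReal (Real.exp ε) +
          ENNReal.ofReal (psi γ 0 ε) * P.rnDeriv Q y ^ γ) ∂Q :=
        lintegral_mono_ae (ae_restrict_of_ae hpointwise)
    _ = ENNReal.ofReal (Real.exp ε) * Q E +
          ENNReal.ofReal (psi γ 0 ε) * ∫⁻ y in E, P.rnDeriv Q y ^ γ ∂Q := by
        rw [lintegral_add_left measurable_const, setLIntegral_const,
          lintegral_const_mul _ (by fun_prop)]
    _ ≤ ENNReal.ofReal (Real.exp ε) * Q E +
          ENNReal.ofReal (psi γ 0 ε) * renyiMoment γ P Q := by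
        gcongr
        exact setLIntegral_le_lintegral _ _

end ApproxDP

/-- The probability measures `P` and `Q` satisfy `D_α(P ‖ Q) ≤ α ρ` for all orders `α ≥ 1`: the
relation that `ρ`-zCDP demands between the output laws on neighbouring inputs, stated through
`renyiMoment`. -/
structure ZCDPBound {Y : Type*} [MeasurableSpace Y] (P Q : Measure Y) (ρ : ℝ) : Prop where
  isProbabilityMeasure_left : IsProbabilityMeasure P
  isProbabilityMeasure_right : IsProbabilityMeasure Q
  absolutelyContinuous : P ≪ Q
  renyiMoment_le : ∀ α : ℝ, 1 ≤ α →
    renyiMoment α P Q ≤ ENNReal.ofReal (Real.exp ((α - 1) * α * ρ))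

namespace ZCDPBound

variable {Y Z : Type*} [MeasurableSpace Y] [MeasurableSpace Z] {P Q : Measure Y} {ρ ρ' : ℝ}

theorem refl (P : Measure Y) [IsProbabilityMeasure P] : ZCDPBound P P 0 where
  isProbabilityMeasure_left := inferInstance
  isProbabilityMeasure_right := inferInstance
  absolutelyContinuous := Measure.AbsolutelyContinuous.rfl
  renyiMoment_le α _ := by simp [renyiMoment_self]

theorem mono (h : ZCDPBound P Q ρ) (hρ : ρ ≤ ρ') : ZCDPBound P Q ρ' where
  __ := h
  renyiMoment_le α hα := by
    have hcoeff : 0 ≤ (α - 1) * α := mul_nonneg (sub_nonneg.2 hα) (zero_le_one.trans hα)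
    exact (h.renyiMoment_le α hα).trans <| ENNReal.ofReal_le_ofReal <|
      Real.exp_le_exp.2 <| mul_le_mul_of_nonneg_left hρ hcoeff

theorem map (h : ZCDPBound P Q ρ) {T : Y → Z} (hT : Measurable T) :
    ZCDPBound (P.map T) (Q.map T) ρ := by
  have := h.isProbabilityMeasure_left
  have := h.isProbabilityMeasure_right
  exact ⟨Measure.isProbabilityMeasure_map hT.aemeasurable,
    Measure.isProbabilityMeasure_map hT.aemeasurable, h.absolutelyContinuous.map hT, fun α hα =>
    (renyiMoment_map_le h.absolutelyContinuous hα hT).trans (h.renyiMoment_le α hα)⟩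

theorem compProd_left (h : ZCDPBound P Q ρ) (κ : Kernel Y Z) [IsMarkovKernel κ] :
    ZCDPBound (P ⊗ₘ κ) (Q ⊗ₘ κ) ρ := by
  have := h.isProbabilityMeasure_left
  have := h.isProbabilityMeasure_right
  exact ⟨inferInstance, inferInstance, h.absolutelyContinuous.compProd_left κ, fun α hα =>
    (renyiMoment_compProd_left α P Q κ).trans_le (h.renyiMoment_le α hα)⟩

theorem compProd [MeasurableSpace.CountableOrCountablyGenerated Y Z] (h : ZCDPBound P Q ρ)
    {κ η : Kernel Y Z} (hκη : ∀ y, ZCDPBound (κ y) (η y) ρ') :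
    ZCDPBound (P ⊗ₘ κ) (Q ⊗ₘ η) (ρ + ρ') := by
  have := h.isProbabilityMeasure_left
  have := h.isProbabilityMeasure_right
  have : IsMarkovKernel κ := ⟨fun y => (hκη y).isProbabilityMeasure_left⟩
  have : IsMarkovKernel η := ⟨fun y => (hκη y).isProbabilityMeasure_right⟩
  have hac := fun y => (hκη y).absolutelyContinuous
  refine ⟨inferInstance, inferInstance,
    h.absolutelyContinuous.compProd (Filter.Eventually.of_forall hac), fun α hα => ?_⟩
  calc renyiMoment α (P ⊗ₘ κ) (Q ⊗ₘ η)
      = ∫⁻ y, renyiMoment α (κ y) (η y) * P.rnDeriv Q y ^ α ∂Q :=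
        renyiMoment_compProd h.absolutelyContinuous hac (zero_le_one.trans hα)
    _ ≤ ∫⁻ y, ENNReal.ofReal (Real.exp ((α - 1) * α * ρ')) * P.rnDeriv Q y ^ α ∂Q := by
        gcongr with y
        exact (hκη y).renyiMoment_le α hα
    _ = ENNReal.ofReal (Real.exp ((α - 1) * α * ρ')) * renyiMoment α P Q :=
        lintegral_const_mul _ (by fun_prop)
    _ ≤ ENNReal.ofReal (Real.exp ((α - 1) * α * ρ')) *
          ENNReal.ofReal (Real.exp ((α - 1) * α * ρ)) := by
        gcongr
        exact h.renyiMoment_le α hα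
    _ = ENNReal.ofReal (Real.exp ((α - 1) * α * (ρ + ρ'))) := by
        rw [← ENNReal.ofReal_mul (Real.exp_nonneg _), ← Real.exp_add, ← mul_add, add_comm ρ']

theorem lintegral_exp_mul_privLoss_le (h : ZCDPBound P Q ρ) {s : ℝ} (hs : 0 ≤ s) :
    ∫⁻ z, ENNReal.ofReal (Real.exp (s * z)) ∂(privLoss P Q) ≤
      ENNReal.ofReal (Real.exp (s * (s + 1) * ρ)) := by
  have := h.isProbabilityMeasure_left
  have := h.isProbabilityMeasure_right
  rw [lintegral_exp_mul_privLoss h.absolutelyContinuous hs]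
  simpa only [add_sub_cancel_right] using h.renyiMoment_le (s + 1) (by linarith)

theorem real_le_exp_mul_real_add_psi (h : ZCDPBound P Q ρ) {γ : ℝ} (hγ : 1 < γ) (ε : ℝ)
    (E : Set Y) : P.real E ≤ Real.exp ε * Q.real E + psi γ ρ ε := by
  have := h.isProbabilityMeasure_left
  have := h.isProbabilityMeasure_right
  have hψ := psi_nonneg hγ.le 0 ε
  refine ENNReal.toReal_le_of_le_ofReal
    (add_nonneg (by positivity) (psi_nonneg hγ.le ρ ε)) ?_
  calc P E ≤ ENNReal.ofReal (Real.exp ε) * Q E +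
          ENNReal.ofReal (psi γ 0 ε) * renyiMoment γ P Q :=
        measure_le_exp_mul_add_psi_zero_mul_renyiMoment h.absolutelyContinuous hγ ε E
    _ ≤ ENNReal.ofReal (Real.exp ε) * Q E +
          ENNReal.ofReal (psi γ 0 ε) * ENNReal.ofReal (Real.exp ((γ - 1) * γ * ρ)) := by
        gcongr
        exact h.renyiMoment_le γ hγ.le
    _ = ENNReal.ofReal (Real.exp ε * Q.real E + psi γ ρ ε) := by
        rw [psi_eq_psi_zero_mul_exp γ ρ ε, ENNReal.ofReal_add (by positivity) (by positivity),
          ENNReal.ofReal_mul (Real.exp_nonneg ε), ENNReal.ofReal_mul hψ, ofReal_measureReal]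

end ZCDPBound

section Gaussian

/-- The likelihood ratio `dN(m, v) / dN(m', v)` at `r`. -/
noncomputable def gaussianRatio (m m' v r : ℝ) : ℝ :=
  Real.exp ((m - m') * (2 * r - m - m') / (2 * v))

@[fun_prop]
theorem measurable_gaussianRatio (m m' v : ℝ) : Measurable (gaussianRatio m m' v) := by
  unfold gaussianRatio
  fun_prop

theorem gaussianReal_eq_withDensity_gaussianRatio (m m' : ℝ) {v : ℝ≥0} (hv : v ≠ 0) :
    gaussianReal m v =
      (gaussianReal m' v).withDensity fun r => ENNReal.ofReal (gaussianRatio m m' v r) := by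
  rw [gaussianReal_of_var_ne_zero _ hv, gaussianReal_of_var_ne_zero _ hv,
    ← withDensity_mul _ (measurable_gaussianPDF _ _) (by fun_prop)]
  congr 1 with r
  rw [Pi.mul_apply, gaussianPDF, gaussianPDF, ← ENNReal.ofReal_mul (gaussianPDFReal_nonneg _ _ _),
    gaussianPDFReal, gaussianPDFReal, gaussianRatio, mul_assoc (√_)⁻¹, ← Real.exp_add]
  congr 3
  field_simp
  ring

theorem renyiMoment_gaussianReal (m m' : ℝ) {v : ℝ≥0} (hv : v ≠ 0) (α : ℝ) :
    renyiMoment α (gaussianReal m v) (gaussianReal m' v) =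
      ENNReal.ofReal (Real.exp ((α - 1) * α * ((m - m') ^ 2 / (2 * v)))) := by
  set c : ℝ := α * (m - m') / v with hc
  set b : ℝ := Real.exp (-(α * (m - m') * (m + m') / (2 * v))) with hb
  have hrpow : ∀ r, ENNReal.ofReal (gaussianRatio m m' v r) ^ α =
      ENNReal.ofReal (b * Real.exp (c * r)) := by
    intro r
    rw [gaussianRatio, ENNReal.ofReal_rpow_of_pos (Real.exp_pos _), ← Real.exp_mul, hb, hc,
      ← Real.exp_add]
    congr 2
    field_simp
    ring
  have hmgf : ∫ r, Real.exp (c * r) ∂(gaussianReal m' v) = Real.exp (m' * c + v * c ^ 2 / 2) :=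
    mgf_gaussianReal (X := id) Measure.map_id c
  rw [gaussianReal_eq_withDensity_gaussianRatio m m' hv,
    renyiMoment_withDensity α _ (by fun_prop)]
  simp only [hrpow]
  rw [← ofReal_integral_eq_lintegral_ofReal ((integrable_exp_mul_gaussianReal c).const_mul b)
    (Filter.Eventually.of_forall fun r => by positivity), integral_const_mul, hmgf, hb, hc,
    ← Real.exp_add]
  congr 2
  field_simp
  ring

theorem zcdpBound_gaussianReal (m m' : ℝ) {v : ℝ≥0} (hv : v ≠ 0) :
    ZCDPBound (gaussianReal m v) (gaussianReal m' v) ((m - m') ^ 2 / (2 * v)) where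
  isProbabilityMeasure_left := inferInstance
  isProbabilityMeasure_right := inferInstance
  absolutelyContinuous := by
    rw [gaussianReal_eq_withDensity_gaussianRatio m m' hv]
    exact withDensity_absolutelyContinuous _ _
  renyiMoment_le α _ := (renyiMoment_gaussianReal m m' hv α).le

end Gaussian

section Mechanism

variable {n : ℕ} {X : Type*} {σ : ℕ → ℝ} {c : ℝ → ℝ} {i : Idx n} {x x' : Dataset n X}

/-- The mechanism that applies `c` to the responses of `M`. The map `c` has to be measurable for
this to be meaningful, since `Kernel.map` is `0` otherwise. -/
noncomputable def Mechanism.postprocess (M : Mechanism X) (c : ℝ → ℝ) : Mechanism X :=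
  fun t s => (M t s).map c

theorem gaussianMechanism_eq_postprocess_id (σ : ℕ → ℝ) :
    gaussianMechanism (X := X) σ = (gaussianMechanism σ).postprocess id :=
  funext₂ fun _ _ => (Kernel.map_id _).symm

theorem gaussianMechanism_apply (σ : ℕ → ℝ) (t : ℕ) (s : Fin t → X) (q : Query X) :
    gaussianMechanism σ t s q = gaussianReal (q.eval s) (Real.toNNReal (σ t ^ 2)) := by
  change (gaussianReal 0 (Real.toNNReal (σ t ^ 2))).map (fun z => q.eval s + z) = _
  rw [gaussianReal_map_const_add, zero_add]

theorem Neighbor.snapshot_apply_eq (h : Neighbor i x x') {t : Idx n} {j : Fin t.1}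
    (hj : j.1 + 1 ≠ i.1) : snapshot x t j = snapshot x' t j :=
  h _ fun hji => hj (congrArg Subtype.val hji)

theorem Neighbor.abs_sum_snapshot_sub_le (h : Neighbor i x x') (t : Idx n) (q : Query X) :
    |∑ j, ((q (snapshot x t j) : ℝ) - q (snapshot x' t j))| ≤ if i ≤ t then 1 else 0 := by
  have hterm : ∀ j : Fin t.1, j.1 + 1 ≠ i.1 →
      (q (snapshot x t j) : ℝ) - q (snapshot x' t j) = 0 := fun j hj => by
    rw [h.snapshot_apply_eq hj, sub_self]
  split_ifs with hit
  · have hi := Finset.mem_Icc.1 i.2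
    have hit : i.1 ≤ t.1 := hit
    let j₀ : Fin t.1 := ⟨i.1 - 1, by omega⟩
    rw [Fintype.sum_eq_single j₀ fun j hj => hterm j fun hji => hj (Fin.ext (by grind))]
    exact Real.dist_le_of_mem_Icc_01 (q (snapshot x t j₀)).2 (q (snapshot x' t j₀)).2
  · have hit : ¬ i.1 ≤ t.1 := hit
    rw [Finset.sum_eq_zero fun j _ => hterm j (by omega), abs_zero]

theorem Neighbor.sq_eval_snapshot_sub_le (h : Neighbor i x x') (t : Idx n) (q : Query X) :
    (q.eval (snapshot x t) - q.eval (snapshot x' t)) ^ 2 ≤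
      (if (i : ℕ) ≤ t then 1 else 0) / (t : ℝ) ^ 2 := by
  rw [Query.eval, Query.eval, ← sub_div, ← Finset.sum_sub_distrib, div_pow, ← sq_abs]
  gcongr
  have hsum := h.abs_sum_snapshot_sub_le t q
  calc |∑ j, ((q (snapshot x t j) : ℝ) - q (snapshot x' t j))| ^ 2
      ≤ (if (i : ℕ) ≤ t then 1 else 0 : ℝ) ^ 2 := by gcongr; exact hsum
    _ = if (i : ℕ) ≤ t then 1 else 0 := by split_ifs <;> norm_num

/-- The zCDP cost at the data point `i` of one query in round `t`, which is the summand of `rho`. -/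
noncomputable def queryCost (σ : ℕ → ℝ) (i t : ℕ) : ℝ :=
  (if i ≤ t then 1 else 0) / (2 * σ t ^ 2 * (t : ℝ) ^ 2)

theorem Neighbor.zcdpBound_gaussianMechanism (h : Neighbor i x x') {t : Idx n} (hσ : σ t ≠ 0)
    (q : Query X) :
    ZCDPBound (gaussianMechanism σ t (snapshot x t) q) (gaussianMechanism σ t (snapshot x' t) q)
      (queryCost σ i t) := by
  have hvar : (Real.toNNReal (σ t ^ 2) : ℝ) = σ t ^ 2 := Real.coe_toNNReal _ (sq_nonneg _)
  have hvar_ne : Real.toNNReal (σ t ^ 2) ≠ 0 := by simpa using hσ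
  rw [gaussianMechanism_apply, gaussianMechanism_apply]
  refine (zcdpBound_gaussianReal _ _ hvar_ne).mono ?_
  rw [hvar]
  calc (q.eval (snapshot x t) - q.eval (snapshot x' t)) ^ 2 / (2 * σ t ^ 2)
      ≤ ((if (i : ℕ) ≤ t then 1 else 0) / (t : ℝ) ^ 2) / (2 * σ t ^ 2) := by
        gcongr
        exact h.sq_eval_snapshot_sub_le t q
    _ = queryCost σ i t := by rw [queryCost, div_div, mul_comm ((t : ℝ) ^ 2)]

theorem Neighbor.zcdpBound_gaussianMechanism_postprocess (h : Neighbor i x x') {t : Idx n}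
    (hσ : σ t ≠ 0) (hc : Measurable c) (q : Query X) :
    ZCDPBound ((gaussianMechanism σ).postprocess c t (snapshot x t) q)
      ((gaussianMechanism σ).postprocess c t (snapshot x' t) q) (queryCost σ i t) := by
  rw [Mechanism.postprocess, Mechanism.postprocess, Kernel.map_apply _ hc, Kernel.map_apply _ hc]
  exact (h.zcdpBound_gaussianMechanism hσ q).map hc

end Mechanism

section Interaction

variable {n : ℕ} {X : Type*} {M : Mechanism X} {A : Analyst n X} {x x' : Dataset n X}
  {P Q : Measure (Transcript n X)} {ρ : ℝ}

theorem bind_queryStep (μ : Measure (Transcript n X)) [SFinite μ] (t : Idx n) :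
    μ.bind (queryStep A M x t) =
      (μ ⊗ₘ A ⊗ₘ (M t (snapshot x t)).prodMkLeft (Transcript n X)).map
        (Transcript.record t ∘ MeasurableEquiv.prodAssoc) := by
  rw [← Measure.map_map (measurable_record t) (MeasurableEquiv.measurable _),
    Measure.compProd_assoc', Measure.compProd_eq_comp_prod,
    Measure.map_comp _ _ (measurable_record t), queryStep]

theorem ZCDPBound.bind_queryStep [IsMarkovKernel A] (h : ZCDPBound P Q ρ) {t : Idx n} {ρ' : ℝ}
    (hM : ∀ q, ZCDPBound (M t (snapshot x t) q) (M t (snapshot x' t) q) ρ') :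
    ZCDPBound (P.bind (queryStep A M x t)) (Q.bind (queryStep A M x' t)) (ρ + ρ') := by
  have := h.isProbabilityMeasure_left
  have := h.isProbabilityMeasure_right
  have : IsMarkovKernel (M t (snapshot x t)) := ⟨fun q => (hM q).isProbabilityMeasure_left⟩
  have : IsMarkovKernel (M t (snapshot x' t)) := ⟨fun q => (hM q).isProbabilityMeasure_right⟩
  rw [GrowingADA.bind_queryStep, GrowingADA.bind_queryStep]
  exact ((h.compProd_left A).compProd fun p => hM p.2).map
    ((measurable_record t).comp (MeasurableEquiv.measurable _))

theorem ZCDPBound.iterate_bind_queryStep [IsMarkovKernel A] (h : ZCDPBound P Q ρ) {t : Idx n}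
    {ρ' : ℝ} (hM : ∀ q, ZCDPBound (M t (snapshot x t) q) (M t (snapshot x' t) q) ρ') (m : ℕ) :
    ZCDPBound ((fun ν : Measure (Transcript n X) => ν.bind (queryStep A M x t))^[m] P)
      ((fun ν : Measure (Transcript n X) => ν.bind (queryStep A M x' t))^[m] Q)
      (ρ + m * ρ') := by
  induction m with
  | zero => simpa using h
  | succ m ih =>
    rw [Function.iterate_succ_apply', Function.iterate_succ_apply', Nat.cast_succ, add_one_mul,
      ← add_assoc]
    exact ih.bind_queryStep hM

theorem ZCDPBound.foldl_iterate_bind_queryStep [IsMarkovKernel A] (h : ZCDPBound P Q ρ)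
    {cost : Idx n → ℝ} (k : ℕ → ℕ) (l : List (Idx n))
    (hM : ∀ t ∈ l, ∀ q, ZCDPBound (M t (snapshot x t) q) (M t (snapshot x' t) q) (cost t)) :
    ZCDPBound
      (l.foldl (fun μ t =>
        (fun ν : Measure (Transcript n X) => ν.bind (queryStep A M x t))^[k t] μ) P)
      (l.foldl (fun μ t =>
        (fun ν : Measure (Transcript n X) => ν.bind (queryStep A M x' t))^[k t] μ) Q)
      (ρ + (l.map fun t : Idx n => (k t : ℝ) * cost t).sum) := by
  induction l generalizing P Q ρ with
  | nil => simpa using h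
  | cons t l ih =>
    rw [List.forall_mem_cons] at hM
    rw [List.foldl_cons, List.foldl_cons, List.map_cons, List.sum_cons, ← add_assoc]
    exact ih (h.iterate_bind_queryStep hM.1 (k t)) hM.2

theorem zcdpBound_interact (A : Analyst n X) [IsMarkovKernel A] {n₀ : ℕ} (k : ℕ → ℕ)
    {cost : Idx n → ℝ} (hM : ∀ t ∈ rounds n n₀, ∀ q,
      ZCDPBound (M t (snapshot x t) q) (M t (snapshot x' t) q) (cost t)) :
    ZCDPBound (interact n₀ k A M x) (interact n₀ k A M x')
      (∑ t ∈ rounds n n₀, k t * cost t) := by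
  have hfold := (ZCDPBound.refl (Measure.dirac (Transcript.empty n X))).foldl_iterate_bind_queryStep
    (A := A) k ((rounds n n₀).sort (· ≤ ·)) fun t ht => hM t ((Finset.mem_sort _).1 ht)
  rwa [← List.sum_toFinset _ (Finset.sort_nodup _ _), Finset.sort_toFinset, zero_add] at hfold

theorem map_subtype_rounds (n : ℕ) {n₀ : ℕ} (hn₀ : 1 ≤ n₀) :
    (rounds n n₀).map (Function.Embedding.subtype _) = Finset.Icc n₀ n := by
  ext τ
  simp only [rounds, Finset.mem_map, Finset.mem_filter_univ, Function.Embedding.subtype_apply,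
    Subtype.exists, exists_and_right, Finset.mem_Icc]
  grind

theorem sum_rounds_queryCost {n₀ : ℕ} (hn₀ : 1 ≤ n₀) (k : ℕ → ℕ) (σ : ℕ → ℝ) (i : Idx n) :
    ∑ t ∈ rounds n n₀, k t * queryCost σ i t = rho n n₀ k σ i := by
  rw [rho, ← map_subtype_rounds n hn₀, Finset.sum_map]
  exact Finset.sum_congr rfl fun t _ => (mul_div_assoc _ _ _).symm

theorem Neighbor.zcdpBound_interact {i : Idx n} (h : Neighbor i x x') (A : Analyst n X)
    [IsMarkovKernel A] {n₀ : ℕ} (hn₀ : 1 ≤ n₀) {σ : ℕ → ℝ}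
    (hσ : ∀ τ ∈ Finset.Icc n₀ n, 0 < σ τ) (k : ℕ → ℕ) {c : ℝ → ℝ} (hc : Measurable c) :
    ZCDPBound (interact n₀ k A ((gaussianMechanism σ).postprocess c) x)
      (interact n₀ k A ((gaussianMechanism σ).postprocess c) x') (rho n n₀ k σ i) := by
  rw [← sum_rounds_queryCost hn₀]
  refine GrowingADA.zcdpBound_interact A k fun t ht =>
    h.zcdpBound_gaussianMechanism_postprocess (hσ t ?_).ne' hc
  rw [← map_subtype_rounds n hn₀]
  exact Finset.mem_map_of_mem _ ht

end Interaction

section OptimalOrder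

open Set Filter Topology

variable {ρ ε γ : ℝ}

/-- The function `log ψ(·, ρ, ε)` on `(1, ∞)`. With `Real.log 0 = 0` it is continuous on the whole
line, and its value at `1` is the limit from the right. -/
noncomputable def logPsi (ρ ε γ : ℝ) : ℝ :=
  (γ - 1) * (γ * ρ - ε) + (γ - 1) * Real.log (γ - 1) - γ * Real.log γ

theorem psi_eq_exp_logPsi (hγ : 1 < γ) (ρ ε : ℝ) : psi γ ρ ε = Real.exp (logPsi ρ ε γ) := by
  have hγ₁ : 0 < γ - 1 := sub_pos.2 hγ
  have hγ₀ : 0 < γ := one_pos.trans hγ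
  have hbase : 1 - γ⁻¹ = (γ - 1) / γ := by field_simp
  have hlog : logPsi ρ ε γ = (γ - 1) * (γ * ρ - ε) + Real.log ((γ - 1) / γ) * γ -
      Real.log (γ - 1) := by
    rw [logPsi, Real.log_div hγ₁.ne' hγ₀.ne']
    ring
  rw [hlog, Real.exp_sub, Real.exp_add, Real.exp_log hγ₁, psi, hbase,
    Real.rpow_def_of_pos (div_pos hγ₁ hγ₀)]

theorem isOptimalOrder_iff_isMinOn_logPsi :
    IsOptimalOrder ρ ε γ ↔ γ ∈ Ioi 1 ∧ IsMinOn (logPsi ρ ε) (Ioi 1) γ := by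
  refine and_congr_right fun hγ => forall₂_congr fun γ' hγ' => ?_
  rw [psi_eq_exp_logPsi hγ, psi_eq_exp_logPsi hγ', Real.exp_le_exp]
  rfl

theorem continuous_logPsi (ρ ε : ℝ) : Continuous (logPsi ρ ε) := by
  have hshift : Continuous fun γ : ℝ => (γ - 1) * Real.log (γ - 1) :=
    Real.continuous_mul_log.comp (continuous_id.sub continuous_const)
  have hquad : Continuous fun γ : ℝ => (γ - 1) * (γ * ρ - ε) := by fun_prop
  exact (hquad.add hshift).sub Real.continuous_mul_log

theorem IsOptimalOrder.psi_le_one (h : IsOptimalOrder ρ ε γ) : psi γ ρ ε ≤ 1 := by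
  have hlim : Tendsto (logPsi ρ ε) (𝓝[>] 1) (𝓝 0) := by
    simpa [logPsi] using ((continuous_logPsi ρ ε).tendsto 1).mono_left nhdsWithin_le_nhds
  rw [psi_eq_exp_logPsi h.1, Real.exp_le_one_iff]
  refine ge_of_tendsto hlim ?_
  filter_upwards [self_mem_nhdsWithin] with γ' hγ'
  exact (isOptimalOrder_iff_isMinOn_logPsi.1 h).2 hγ'

/-- The derivative of `logPsi` on `(1, ∞)`. -/
noncomputable def derivLogPsi (ρ ε γ : ℝ) : ℝ := (2 * γ - 1) * ρ - ε + Real.log (1 - γ⁻¹)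

theorem hasDerivAt_logPsi (ρ ε : ℝ) (hγ : 1 < γ) :
    HasDerivAt (logPsi ρ ε) (derivLogPsi ρ ε γ) γ := by
  have hγ₁ : γ - 1 ≠ 0 := (sub_pos.2 hγ).ne'
  have hγ₀ : γ ≠ 0 := (one_pos.trans hγ).ne'
  have hbase : 1 - γ⁻¹ = (γ - 1) / γ := by field_simp
  have hsub : HasDerivAt (fun γ : ℝ => γ - 1) 1 γ := (hasDerivAt_id γ).sub_const 1
  have hlin : HasDerivAt (fun γ : ℝ => γ * ρ - ε) (1 * ρ) γ :=
    ((hasDerivAt_id γ).mul_const ρ).sub_const ε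
  have hshift : HasDerivAt (fun γ : ℝ => (γ - 1) * Real.log (γ - 1)) (Real.log (γ - 1) + 1) γ :=
    (Real.hasDerivAt_mul_log hγ₁).comp_sub_const γ 1
  refine (((hsub.mul hlin).add hshift).sub (Real.hasDerivAt_mul_log hγ₀)).congr_deriv ?_
  rw [derivLogPsi, hbase, Real.log_div hγ₁ hγ₀]
  ring

theorem strictMonoOn_derivLogPsi (hρ : 0 ≤ ρ) (ε : ℝ) :
    StrictMonoOn (derivLogPsi ρ ε) (Ioi 1) := by
  intro a (ha : 1 < a) b _ hab
  have hinv : b⁻¹ < a⁻¹ := inv_strictAnti₀ (one_pos.trans ha) hab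
  have hbase : 0 < 1 - a⁻¹ := sub_pos.2 (inv_lt_one_of_one_lt₀ ha)
  have hlog : Real.log (1 - a⁻¹) < Real.log (1 - b⁻¹) := Real.log_lt_log hbase (by gcongr)
  have hlin : (2 * a - 1) * ρ ≤ (2 * b - 1) * ρ := by gcongr
  unfold derivLogPsi
  linarith

theorem continuousOn_derivLogPsi (ρ ε : ℝ) : ContinuousOn (derivLogPsi ρ ε) (Ioi 1) := by
  have hinv : ContinuousOn (fun γ : ℝ => 1 - γ⁻¹) (Ioi 1) :=
    continuousOn_const.sub (continuousOn_id.inv₀ fun γ hγ => (one_pos.trans hγ).ne')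
  have hlin : Continuous fun γ : ℝ => (2 * γ - 1) * ρ - ε := by fun_prop
  exact hlin.continuousOn.add
    (hinv.log fun γ hγ => (sub_pos.2 (inv_lt_one_of_one_lt₀ (mem_Ioi.1 hγ))).ne')

theorem tendsto_derivLogPsi_atTop (hρ : 0 < ρ) (ε : ℝ) :
    Tendsto (derivLogPsi ρ ε) atTop atTop := by
  have hlin : Tendsto (fun γ : ℝ => (2 * γ - 1) * ρ - ε) atTop atTop :=
    tendsto_atTop_add_const_right _ _ <| (tendsto_atTop_add_const_right _ _ <|
      tendsto_id.const_mul_atTop two_pos).atTop_mul_const hρ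
  have hbase : Tendsto (fun γ : ℝ => 1 - γ⁻¹) atTop (𝓝 1) := by
    simpa using tendsto_inv_atTop_zero.const_sub (1 : ℝ)
  exact hlin.atTop_add (hbase.log one_ne_zero)

theorem tendsto_derivLogPsi_nhdsGT_one (ρ ε : ℝ) :
    Tendsto (derivLogPsi ρ ε) (𝓝[>] 1) atBot := by
  have hlin : Continuous fun γ : ℝ => (2 * γ - 1) * ρ - ε := by fun_prop
  have hbase : Tendsto (fun γ : ℝ => 1 - γ⁻¹) (𝓝[>] 1) (𝓝[>] 0) := by
    refine tendsto_nhdsWithin_iff.2 ⟨?_, ?_⟩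
    · have hinv := (continuousAt_inv₀ (one_ne_zero (α := ℝ))).tendsto.const_sub 1
      simpa using hinv.mono_left nhdsWithin_le_nhds
    · filter_upwards [self_mem_nhdsWithin] with γ hγ
      exact sub_pos.2 (inv_lt_one_of_one_lt₀ (mem_Ioi.1 hγ))
  exact ((hlin.tendsto 1).mono_left nhdsWithin_le_nhds).add_atBot
    (Real.tendsto_log_nhdsGT_zero.comp hbase)

theorem exists_derivLogPsi_eq_zero (hρ : 0 < ρ) (ε : ℝ) :
    ∃ γ ∈ Ioi 1, derivLogPsi ρ ε γ = 0 :=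
  isPreconnected_Ioi.intermediate_value_Iii (l₁ := 𝓝[>] 1)
    (le_principal_iff.2 self_mem_nhdsWithin) (le_principal_iff.2 (Ioi_mem_atTop 1))
    (continuousOn_derivLogPsi ρ ε) (tendsto_derivLogPsi_nhdsGT_one ρ ε)
    (tendsto_derivLogPsi_atTop hρ ε) (mem_univ 0)

theorem strictConvexOn_logPsi (hρ : 0 ≤ ρ) (ε : ℝ) :
    StrictConvexOn ℝ (Ioi 1) (logPsi ρ ε) := by
  refine StrictMonoOn.strictConvexOn_of_deriv (convex_Ioi 1)
    (continuous_logPsi ρ ε).continuousOn ?_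
  rw [interior_Ioi]
  exact (strictMonoOn_derivLogPsi hρ ε).congr fun γ hγ => (hasDerivAt_logPsi ρ ε hγ).deriv.symm

theorem existsUnique_isOptimalOrder (hρ : 0 < ρ) (ε : ℝ) :
    ∃! γ : ℝ, IsOptimalOrder ρ ε γ := by
  have hconv := strictConvexOn_logPsi hρ.le ε
  obtain ⟨γ, hγ, hzero⟩ := exists_derivLogPsi_eq_zero hρ ε
  have hmin : IsMinOn (logPsi ρ ε) (Ioi 1) γ := by
    refine hconv.convexOn.isMinOn_of_rightDeriv_eq_zero (by rwa [interior_Ioi]) ?_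
    rw [(hasDerivAt_logPsi ρ ε hγ).hasDerivWithinAt.derivWithin (uniqueDiffWithinAt_Ioi γ), hzero]
  refine ⟨γ, isOptimalOrder_iff_isMinOn_logPsi.2 ⟨hγ, hmin⟩, fun γ' h => ?_⟩
  obtain ⟨hγ', hmin'⟩ := isOptimalOrder_iff_isMinOn_logPsi.1 h
  exact hconv.eq_of_isMinOn hmin' hmin hγ' hγ

theorem psi_mono (hγ : 1 ≤ γ) (ε : ℝ) : Monotone fun ρ => psi γ ρ ε := by
  intro ρ ρ' hρ
  have hcoeff : 0 ≤ (γ - 1) * γ := mul_nonneg (sub_nonneg.2 hγ) (zero_le_one.trans hγ)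
  change psi γ ρ ε ≤ psi γ ρ' ε
  rw [psi_eq_psi_zero_mul_exp γ ρ, psi_eq_psi_zero_mul_exp γ ρ']
  exact mul_le_mul_of_nonneg_left (Real.exp_le_exp.2 (mul_le_mul_of_nonneg_left hρ hcoeff))
    (psi_nonneg hγ 0 ε)

end OptimalOrder

section Rho

variable {n n₀ : ℕ} {k : ℕ → ℕ} {σ : ℕ → ℝ}

theorem rho_nonneg (n n₀ : ℕ) (k : ℕ → ℕ) (σ : ℕ → ℝ) (t : Idx n) : 0 ≤ rho n n₀ k σ t := by
  refine Finset.sum_nonneg fun τ _ => ?_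
  split_ifs <;> positivity

theorem rho_le_iSup (t : Idx n) : rho n n₀ k σ t ≤ ⨆ t, rho n n₀ k σ t :=
  le_ciSup (Set.finite_range _).bddAbove t

theorem iSup_rho_pos (hn₀ : 1 ≤ n₀) (hσ : ∀ τ ∈ Finset.Icc n₀ n, 0 < σ τ)
    (hk : ∃ τ ∈ Finset.Icc n₀ n, 0 < k τ) : 0 < ⨆ t : Idx n, rho n n₀ k σ t := by
  obtain ⟨τ, hτ, hkτ⟩ := hk
  have hστ := hσ τ hτ
  have hτ₀ : 1 ≤ τ := hn₀.trans (Finset.mem_Icc.1 hτ).1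
  refine lt_of_lt_of_le ?_
    (rho_le_iSup ⟨τ, Finset.mem_Icc.2 ⟨hτ₀, (Finset.mem_Icc.1 hτ).2⟩⟩)
  refine Finset.sum_pos' (fun τ' _ => ?_) ⟨τ, hτ, ?_⟩
  · split_ifs <;> positivity
  · rw [if_pos le_rfl]
    positivity

end Rho

end GrowingADA

theorem mainTheorem8_general {X : Type*} (n n₀ : ℕ) (hn₀ : 1 ≤ n₀) (σ : ℕ → ℝ)
    (hσ : ∀ τ ∈ Finset.Icc n₀ n, 0 < σ τ) (k : ℕ → ℕ) (c : ℝ → ℝ) (hc : Measurable c) :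
    InteractionZCDP n₀ k ((gaussianMechanism (X := X) σ).postprocess c) (rho n n₀ k σ) ∧
    ∀ ε : ℝ, 0 ≤ ε →
      ((∃ τ ∈ Finset.Icc n₀ n, 0 < k τ) →
        ∃! γ : ℝ, IsOptimalOrder (⨆ t : Idx n, rho n n₀ k σ t) ε γ) ∧
      ∀ γ : ℝ, IsOptimalOrder (⨆ t : Idx n, rho n n₀ k σ t) ε γ →
        InteractionDP n₀ k ((gaussianMechanism (X := X) σ).postprocess c) ε
          (fun t : Idx n => psi γ (rho n n₀ k σ t) ε) := by
  refine ⟨fun A _ => ⟨rho_nonneg n n₀ k σ, fun i x x' h => ?_⟩, fun ε hε =>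
    ⟨fun hk => existsUnique_isOptimalOrder (iSup_rho_pos hn₀ hσ hk) ε, fun γ hγ A _ =>
      ⟨hε, fun i => ⟨psi_nonneg hγ.1.le _ _, ?_⟩, fun i x x' h E _ => ?_⟩⟩⟩
  · have hbound := h.zcdpBound_interact A hn₀ hσ k hc
    exact ⟨hbound.absolutelyContinuous, fun s hs => hbound.lintegral_exp_mul_privLoss_le hs⟩
  · exact (psi_mono hγ.1.le ε (rho_le_iSup i)).trans hγ.psi_le_one
  · exact (h.zcdpBound_interact A hn₀ hσ k hc).real_le_exp_mul_real_add_psi hγ.1 ε E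

theorem mainTheorem8 {X : Type*} [Finite X] (n n₀ : ℕ) (hn₀ : 1 ≤ n₀) (hn : n₀ ≤ n)
    (σ : ℕ → ℝ) (hσ : ∀ τ ∈ Finset.Icc n₀ n, 0 < σ τ) (k : ℕ → ℕ) (M : Mechanism X)
    (hM : M = gaussianMechanism σ ∨ M = clippedGaussianMechanism σ) :
    InteractionZCDP n₀ k M (rho n n₀ k σ) ∧
    ∀ ε : ℝ, 0 < ε →
      ((∃ τ ∈ Finset.Icc n₀ n, 0 < k τ) →
        ∃! γ : ℝ, IsOptimalOrder (⨆ t : Idx n, rho n n₀ k σ t) ε γ) ∧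
      ∀ γ : ℝ, IsOptimalOrder (⨆ t : Idx n, rho n n₀ k σ t) ε γ →
        InteractionDP n₀ k M ε (fun t : Idx n => psi γ (rho n n₀ k σ t) ε) := by
  rcases hM with rfl | rfl
  · rw [gaussianMechanism_eq_postprocess_id]
    exact (mainTheorem8_general n n₀ hn₀ σ hσ k id measurable_id).imp_right fun h ε hε => h ε hε.le
  · exact (mainTheorem8_general n n₀ hn₀ σ hσ k clamp measurable_clamp).imp_right
      fun h ε hε => h ε hε.le
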